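/- **Proposition 2.1.** Work with real-valued functions on $\mathbf R$; $\|\cdot\|$ denotes the $L^2(\mathbf R)$-norm, $\|\cdot\|_\infty$ the $L^\infty(\mathbf R)$-norm, and $\nabla=\partial_x$, $\Delta=\partial_x^2$. Let $V\in BC^1(\mathbf R)$ (that is, $V$ is continuously differentiable, and $V$ and $V'$ are bounded) satisfy $V(x)>0$ for all $x\in\mathbf R$, and let $u_0,u_1\in H^2(\mathbf R)$ satisfy $$\frac{u_0+u_1-\Delta u_1}{\sqrt{V}}\in L^2(\mathbf R).$$ Let $u\in C^2([0,\infty);H^2(\mathbf R))$ be the strong solution of $$u_{tt}-u_{ttxx}-u_{xx}+V(x)u+u_t=0\quad (t>0,\ x\in\mathbf R),\qquad u(0,\cdot)=u_0,\quad u_t(0,\cdot)=u_1,$$ where the equation is understood in $L^2(\mathbf R)$ for every $t>0$. Then the total energy $$E_u(t)=\tfrac12\left(\|u_t(t,\cdot)\|^2+\|\nabla u_t(t,\cdot)\|^2+\|\nabla u(t,\cdot)\|^2+\|\sqrt{V}\,u(t,\cdot)\|^2\right)$$ satisfies $$E_u(t)\le C\left(\|u_0\|_{H^2}^2+\|u_1\|_{H^2}^2+\left\|\frac{u_0+u_1-\Delta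 u_1}{\sqrt V}\right\|^2\right)(1+t)^{-1}\qquad (t\ge 0),$$ where $C=C(\|V\|_\infty,\|V'\|_\infty)>0$ is a constant depending only on $\|V\|_\infty$ and $\|V'\|_\infty$. -/

import Mathlib

open MeasureTheory Set
open scoped ContDiff ENNReal

/-- `f ∈ BC(ℝ)`: continuous and bounded. -/
def IsBC (f : ℝ → ℝ) : Prop :=
  Continuous f ∧ ∃ M : ℝ, ∀ x, |f x| ≤ M

/-- `f ∈ BC¹(ℝ)`: differentiable, with `f` and `f'` continuous and bounded. -/
def IsBC1 (f : ℝ → ℝ) : Prop :=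
  Differentiable ℝ f ∧ IsBC f ∧ IsBC (deriv f)

/-- Real-valued `L²(ℝ)` with respect to Lebesgue measure. -/
abbrev L2R : Type := Lp ℝ 2 (volume : Measure ℝ)

/-- `g` is the weak (distributional) derivative of `f`, for `f, g ∈ L²(ℝ)`:
`∫ f φ' = - ∫ g φ` for all test functions `φ ∈ C_c^∞(ℝ)`. -/
def IsWeakDeriv (f g : L2R) : Prop :=
  ∀ φ : ℝ → ℝ, ContDiff ℝ ∞ φ → HasCompactSupport φ →
    ∫ x, f x * deriv φ x = - ∫ x, g x * φ x

theorem integrable_L2R_mul (f : L2R) {φ : ℝ → ℝ} (hφ : Continuous φ)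
    (hc : HasCompactSupport φ) : Integrable (fun x => f x * φ x) :=
  (Lp.memLp f).integrable_mul (q := 2) (hφ.memLp_of_hasCompactSupport hc)

theorem IsWeakDeriv.zero : IsWeakDeriv 0 0 := by
  intro φ _ _
  have h : ∀ ψ : ℝ → ℝ, ∫ x, (0 : L2R) x * ψ x = 0 := fun ψ => by
    refine integral_eq_zero_of_ae ?_
    filter_upwards [Lp.coeFn_zero ℝ 2 (volume : Measure ℝ)] with x hx
    rw [hx, Pi.zero_apply, zero_mul]
  rw [h, h, neg_zero]

theorem IsWeakDeriv.add {f g f' g' : L2R} (h : IsWeakDeriv f g) (h' : IsWeakDeriv f' g') :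
    IsWeakDeriv (f + f') (g + g') := by
  intro φ hφ hc
  have key : ∀ (a b : L2R) (ψ : ℝ → ℝ), Continuous ψ → HasCompactSupport ψ →
      ∫ x, (a + b : L2R) x * ψ x = (∫ x, a x * ψ x) + ∫ x, b x * ψ x := by
    intro a b ψ hψ hψc
    rw [← integral_add (integrable_L2R_mul a hψ hψc) (integrable_L2R_mul b hψ hψc)]
    refine integral_congr_ae ?_
    filter_upwards [Lp.coeFn_add a b] with x hx
    rw [hx, Pi.add_apply, add_mul]
  rw [key _ _ _ (hφ.continuous_deriv (by simp)) hc.deriv, key _ _ _ hφ.continuous hc,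
    h φ hφ hc, h' φ hφ hc]
  ring

theorem IsWeakDeriv.smul {f g : L2R} (c : ℝ) (h : IsWeakDeriv f g) :
    IsWeakDeriv (c • f) (c • g) := by
  intro φ hφ hc
  have key : ∀ (a : L2R) (ψ : ℝ → ℝ),
      ∫ x, (c • a : L2R) x * ψ x = c * ∫ x, a x * ψ x := by
    intro a ψ
    rw [← integral_const_mul]
    refine integral_congr_ae ?_
    filter_upwards [Lp.coeFn_smul c a] with x hx
    rw [hx, Pi.smul_apply, smul_eq_mul, mul_assoc]
  rw [key, key, h φ hφ hc]
  ring

/-- The Sobolev space `H²(ℝ)`, as a subspace of `L² × L² × L²`. A function `f ∈ H²(ℝ)` is recorded together with its (uniquely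
determined) weak derivatives, as the triple `(f, f', f'')`. The norm inherited
from the `ℓ²`-product is the usual one, `‖f‖²_{H²} = ‖f‖² + ‖f'‖² + ‖f''‖²`. -/
def h2Submodule : Submodule ℝ (PiLp 2 (fun _ : Fin 3 => L2R)) where
  carrier := {w | IsWeakDeriv (w 0) (w 1) ∧ IsWeakDeriv (w 1) (w 2)}
  zero_mem' := ⟨IsWeakDeriv.zero, IsWeakDeriv.zero⟩
  add_mem' h h' := ⟨h.1.add h'.1, h.2.add h'.2⟩
  smul_mem' c _ h := ⟨h.1.smul c, h.2.smul c⟩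

/-- The Sobolev space `H²(ℝ)` as a normed space. -/
abbrev H2 : Type := h2Submodule

namespace H2

/-- The function `f ∈ L²(ℝ)` underlying an element of `H²(ℝ)`. -/
def fn (f : H2) : L2R := f.1 0

/-- The gradient `∇f = f'`. -/
def grad (f : H2) : L2R := f.1 1

/-- The Laplacian `Δf = f''`. -/
def lap (f : H2) : L2R := f.1 2

end H2

/-- The time derivative `u_t` on `[0, ∞)` (one-sided at `t = 0`) of an `H²`-valued map. -/
noncomputable def timeDeriv (u : ℝ → H2) : ℝ → H2 := derivWithin u (Ici 0)

/-- `u ∈ C²([0, ∞); H²(ℝ))` is a strong solution of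
`u_tt - u_ttxx - u_xx + V u + u_t = 0`, `u(0) = u₀`, `u_t(0) = u₁`:
for every `t > 0` the equation holds in `L²(ℝ)`, i.e. for almost every `x`.
Only the values `u t` with `t ≥ 0` matter. -/
structure IsStrongSolution (V : ℝ → ℝ) (u₀ u₁ : H2) (u : ℝ → H2) : Prop where
  contDiffOn : ContDiffOn ℝ 2 u (Ici 0)
  init : u 0 = u₀
  init_deriv : timeDeriv u 0 = u₁
  eqn : ∀ t : ℝ, 0 < t → ∀ᵐ x : ℝ,
    (timeDeriv (timeDeriv u) t).fn x - (timeDeriv (timeDeriv u) t).lap x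
      - (u t).lap x + V x * (u t).fn x + (timeDeriv u t).fn x = 0

/-- The total energy
`E_u(t) = ½ (‖u_t(t)‖² + ‖∇u_t(t)‖² + ‖∇u(t)‖² + ‖√V u(t)‖²)`, with `L²(ℝ)`-norms. -/
noncomputable def energy (V : ℝ → ℝ) (u : ℝ → H2) (t : ℝ) : ℝ :=
  1 / 2 * (‖(timeDeriv u t).fn‖ ^ 2 + ‖(timeDeriv u t).grad‖ ^ 2 + ‖(u t).grad‖ ^ 2
    + lpNorm (fun x => √(V x) * (u t).fn x) 2 volume ^ 2)

open Filter Topology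
open scoped RealInnerProductSpace Convolution

/-! ### Translations in `L²(ℝ)` and weak derivatives -/

/-! Write E for the total energy, M for the squared norm of √V u and n for the sup norm of V'. Three
multipliers are used. Testing with u_t gives E' = -‖u_t‖². Testing with -Δu_t gives an identity for
`secondEnergy`, whose derivative is -‖∇u_t‖² + ⟪V' u_t, ∇u⟫. Testing with u gives one for
`crossEnergy`, whose derivative is ‖u_t‖² + ‖∇u_t‖² - ‖∇u‖² - M. The second supplies the dissipation
of ∇u_t that E' lacks, and the third that of the potential part of E.

In L = (8n² + 2)E + 2 `secondEnergy` + `crossEnergy`, the large multiple of E absorbs the V' terms,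
so that L ≥ 0 (`lyapunov_nonneg`) and L' ≤ -E (`exists_hasDerivWithinAt_lyapunov`). Since E is
nonincreasing, L + (1 + t)E is nonincreasing too, whence (1 + t)E(t) ≤ L(0) + E(0), which the H²
norms of the data control.

The integrations by parts, `IsWeakDeriv.inner_add_inner` and `IsWeakDeriv.inner_mulL_add`, come from
differentiating translations in L². -/

theorem inner_L2R (f g : L2R) : ⟪f, g⟫ = ∫ x, f x * g x := by
  rw [L2.inner_def]
  simp only [RCLike.inner_apply, conj_trivial, mul_comm]

theorem integrable_L2R_mul_L2R (f g : L2R) : Integrable (fun x => f x * g x) :=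
  (Lp.memLp f).integrable_mul (q := 2) (Lp.memLp g)

/-- The translate `x ↦ f (x + s)` of `f ∈ L²(ℝ)`. -/
noncomputable def shift (s : ℝ) (f : L2R) : L2R :=
  Lp.compMeasurePreserving (fun x => x + s) (measurePreserving_add_right volume s) f

theorem coeFn_shift (s : ℝ) (f : L2R) : shift s f =ᵐ[volume] fun x => f (x + s) :=
  Lp.coeFn_compMeasurePreserving f (measurePreserving_add_right volume s)

theorem shift_zero (f : L2R) : shift 0 f = f := by
  refine Lp.ext ?_
  filter_upwards [coeFn_shift 0 f] with x hx
  rw [hx, add_zero]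

theorem continuous_shift (f : L2R) : Continuous (fun s => shift s f) := by
  refine Continuous.compMeasurePreservingLp (f := fun _ : ℝ => f)
    (g := fun s : ℝ => (⟨fun x => x + s, by fun_prop⟩ : C(ℝ, ℝ))) continuous_const ?_
    (fun s => measurePreserving_add_right volume s) (by simp)
  exact ContinuousMap.continuous_of_continuous_uncurry _ (by
    change Continuous fun p : ℝ × ℝ => p.2 + p.1
    fun_prop)

theorem integral_mul_shift_mul_shift (W : ℝ → ℝ) (s : ℝ) (f g : L2R) :
    ∫ x, W x * (shift s f x * shift s g x) = ∫ x, W (x - s) * (f x * g x) := by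
  rw [← integral_add_right_eq_self (fun x => W (x - s) * (f x * g x)) s]
  refine integral_congr_ae ?_
  filter_upwards [coeFn_shift s f, coeFn_shift s g] with x hf hg
  rw [hf, hg, add_sub_cancel_right]

theorem inner_shift_shift (s : ℝ) (f g : L2R) : ⟪shift s f, shift s g⟫ = ⟪f, g⟫ := by
  simpa [inner_L2R] using integral_mul_shift_mul_shift (fun _ => 1) s f g

theorem integral_shift_mul (s : ℝ) (f : L2R) (φ : ℝ → ℝ) :
    ∫ x, shift s f x * φ x = ∫ x, f x * φ (x - s) := by
  rw [← integral_add_right_eq_self (fun x => f x * φ (x - s)) s]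
  refine integral_congr_ae ?_
  filter_upwards [coeFn_shift s f] with x hf
  rw [hf, add_sub_cancel_right]

theorem locallyIntegrable_L2R (f : L2R) : LocallyIntegrable (fun x => f x) :=
  (Lp.memLp f).locallyIntegrable (by norm_num)

theorem eq_of_forall_integral_mul_eq {f g : L2R}
    (h : ∀ φ : ℝ → ℝ, ContDiff ℝ ∞ φ → HasCompactSupport φ →
      ∫ x, f x * φ x = ∫ x, g x * φ x) : f = g := by
  refine Lp.ext (ae_eq_of_integral_contDiff_smul_eq (locallyIntegrable_L2R f)
    (locallyIntegrable_L2R g) fun φ hφ hc => ?_)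
  simpa [mul_comm] using h φ hφ hc

/-- The pairing is the convolution of f with the reflected test function. Differentiation falls on
the smooth factor, and the weak derivative moves it back to f. -/
theorem IsWeakDeriv.hasDerivAt_integral_shift_mul {f g : L2R} (h : IsWeakDeriv f g)
    {φ : ℝ → ℝ} (hφ : ContDiff ℝ ∞ φ) (hc : HasCompactSupport φ) (s : ℝ) :
    HasDerivAt (fun s => ∫ x, shift s f x * φ x) (∫ x, shift s g x * φ x) s := by
  have hcn : HasCompactSupport fun y => φ (-y) := hc.comp_homeomorph (Homeomorph.neg ℝ)
  have hφn : ContDiff ℝ 1 fun y => φ (-y) := (hφ.of_le (by simp)).comp contDiff_neg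
  have H := hcn.hasDerivAt_convolution_right (ContinuousLinearMap.mul ℝ ℝ)
    (locallyIntegrable_L2R f) hφn s
  have e : (fun s => ∫ x, shift s f x * φ x) =
      ((fun x => f x) ⋆[ContinuousLinearMap.mul ℝ ℝ, volume] fun y => φ (-y)) := by
    funext s
    rw [integral_shift_mul, convolution_def]
    simp
  rw [e]
  suffices hs : ∫ x, shift s g x * φ x =
      ((fun x => f x) ⋆[ContinuousLinearMap.mul ℝ ℝ, volume] deriv fun y => φ (-y)) s by
    rw [hs]
    exact H
  rw [integral_shift_mul, convolution_def]
  have hφs : ContDiff ℝ ∞ fun x => φ (x - s) := hφ.comp (contDiff_id.sub contDiff_const)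
  have hcs : HasCompactSupport fun x => φ (x - s) :=
    hc.comp_homeomorph (Homeomorph.subRight s)
  have hw := h _ hφs hcs
  rw [← neg_eq_iff_eq_neg] at hw
  rw [← hw, ← integral_neg]
  refine integral_congr_ae (Eventually.of_forall fun x => ?_)
  have e1 : deriv (fun x => φ (x - s)) x = deriv φ (x - s) := deriv_comp_sub_const ..
  have e2 : deriv (fun y => φ (-y)) (s - x) = - deriv φ (x - s) := by
    rw [deriv_comp_neg, neg_sub]
  simp [e1, e2]

theorem inner_toLp_right (f : L2R) {φ : ℝ → ℝ} (hφ : MemLp φ 2 volume) :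
    ⟪hφ.toLp φ, f⟫ = ∫ x, f x * φ x := by
  rw [inner_L2R]
  refine integral_congr_ae ?_
  filter_upwards [hφ.coeFn_toLp] with x hx
  rw [hx, mul_comm]

theorem IsWeakDeriv.shift_sub_eq_integral {f g : L2R} (h : IsWeakDeriv f g) (s : ℝ) :
    shift s f - f = ∫ r in (0 : ℝ)..s, shift r g := by
  refine eq_of_forall_integral_mul_eq fun φ hφ hc => ?_
  have hm : MemLp φ 2 volume := hφ.continuous.memLp_of_hasCompactSupport hc
  rw [← inner_toLp_right _ hm, ← inner_toLp_right _ hm]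
  have hi : ∀ s, IntervalIntegrable (fun r => shift r g) volume 0 s := fun s =>
    (continuous_shift g).intervalIntegrable _ _
  rw [← innerSL_apply_apply ℝ, ← innerSL_apply_apply ℝ,
    ← ContinuousLinearMap.intervalIntegral_comp_comm _ (hi s)]
  simp only [innerSL_apply_apply, inner_sub_right]
  rw [intervalIntegral.integral_eq_sub_of_hasDerivAt
    (f := fun s => ⟪hm.toLp φ, shift s f⟫) (fun r _ => ?_)
    ((continuous_const.inner (continuous_shift g)).intervalIntegrable _ _), shift_zero]
  simp only [inner_toLp_right]
  exact h.hasDerivAt_integral_shift_mul hφ hc r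

theorem IsWeakDeriv.hasDerivAt_shift {f g : L2R} (h : IsWeakDeriv f g) :
    HasDerivAt (fun s => shift s f) g 0 := by
  have H := intervalIntegral.integral_hasDerivAt_right
    ((continuous_shift g).intervalIntegrable 0 0)
    (continuous_shift g).stronglyMeasurable.stronglyMeasurableAtFilter
    (continuous_shift g).continuousAt
  rw [shift_zero] at H
  have e : (fun s => shift s f) = fun s => f + ∫ r in (0 : ℝ)..s, shift r g := by
    funext s
    rw [← h.shift_sub_eq_integral, add_sub_cancel]
  rw [e]
  exact H.const_add f

/-- Translating both factors leaves the inner product unchanged, so its derivative at s = 0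
vanishes; the product rule gives the left-hand side. -/
theorem IsWeakDeriv.inner_add_inner {f f' g g' : L2R} (hf : IsWeakDeriv f f')
    (hg : IsWeakDeriv g g') : ⟪f, g'⟫ + ⟪f', g⟫ = 0 := by
  have H := hf.hasDerivAt_shift.inner ℝ hg.hasDerivAt_shift
  simp only [inner_shift_shift, shift_zero] at H
  exact H.unique (hasDerivAt_const _ _)

/-! ### Multiplication by bounded functions -/

/-- Multiplication by an essentially bounded function on `L²(ℝ)`. -/
noncomputable def mulL {W : ℝ → ℝ} (hW : MemLp W ∞ volume) : L2R →L[ℝ] L2R :=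
  (ContinuousLinearMap.mul ℝ ℝ).holderL volume ∞ 2 2 (hW.toLp W)

theorem coeFn_mulL {W : ℝ → ℝ} (hW : MemLp W ∞ volume) (f : L2R) :
    mulL hW f =ᵐ[volume] fun x => W x * f x := by
  filter_upwards [(ContinuousLinearMap.mul ℝ ℝ).coeFn_holder (r := 2) (hW.toLp W) f,
    hW.coeFn_toLp] with x h1 h2
  rw [← h2]
  exact h1

theorem inner_mulL {W : ℝ → ℝ} (hW : MemLp W ∞ volume) (f g : L2R) :
    ⟪mulL hW f, g⟫ = ∫ x, W x * (f x * g x) := by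
  rw [inner_L2R]
  refine integral_congr_ae ?_
  filter_upwards [coeFn_mulL hW f] with x hx
  rw [hx, mul_assoc]

theorem inner_mulL_comm {W : ℝ → ℝ} (hW : MemLp W ∞ volume) (f g : L2R) :
    ⟪mulL hW f, g⟫ = ⟪mulL hW g, f⟫ := by
  simp only [inner_mulL, mul_comm]

theorem norm_mulL_le {W : ℝ → ℝ} (hW : MemLp W ∞ volume) (f : L2R) :
    ‖mulL hW f‖ ≤ lpNorm W ∞ volume * ‖f‖ := by
  refine Lp.norm_le_mul_norm_of_ae_le_mul ?_
  filter_upwards [coeFn_mulL hW f, ae_le_lpNorm_exponent_top hW] with x h1 h2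
  rw [h1, norm_mul]
  gcongr

theorem IsBC.memLp_top {W : ℝ → ℝ} (hW : IsBC W) : MemLp W ∞ volume := by
  obtain ⟨M, hM⟩ := hW.2
  exact memLp_top_of_bound hW.1.aestronglyMeasurable M (Eventually.of_forall hM)

theorem lpNorm_sqrt_mul_sq {W : ℝ → ℝ} (hW : IsBC W) (hpos : ∀ x, 0 ≤ W x) (f : L2R) :
    lpNorm (fun x => √(W x) * f x) 2 volume ^ 2 = ⟪mulL hW.memLp_top f, f⟫ := by
  have hm : AEStronglyMeasurable (fun x => √(W x) * f x) volume :=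
    (hW.1.sqrt.aestronglyMeasurable).mul (Lp.aestronglyMeasurable f)
  have hnn : 0 ≤ ∫ x, ‖√(W x) * f x‖ ^ (2 : ℝ) := integral_nonneg fun x => by positivity
  rw [lpNorm_eq_integral_norm_rpow_toReal (by simp) (by simp) hm, inner_mulL]
  simp only [ENNReal.toReal_ofNat]
  rw [← Real.rpow_natCast, ← Real.rpow_mul hnn]
  norm_num
  refine integral_congr_ae (Eventually.of_forall fun x => ?_)
  simp only [mul_pow, sq_abs, Real.sq_sqrt (hpos x)]
  ring

theorem IsBC1.hasDerivAt_integral_sub_mul {W : ℝ → ℝ} (hW : IsBC1 W) {F : ℝ → ℝ}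
    (hF : Integrable F) :
    HasDerivAt (fun s => ∫ x, W (x - s) * F x) (- ∫ x, deriv W x * F x) 0 := by
  obtain ⟨M, hM⟩ := hW.2.1.2
  obtain ⟨M', hM'⟩ := hW.2.2.2
  have hmeas : ∀ {Z : ℝ → ℝ}, Continuous Z → ∀ s : ℝ,
      AEStronglyMeasurable (fun x => Z (x - s) * F x) volume := fun hZ s =>
    (hZ.comp (continuous_id.sub continuous_const)).aestronglyMeasurable.mul
      hF.aestronglyMeasurable
  have H := (hasDerivAt_integral_of_dominated_loc_of_deriv_le (μ := volume) (x₀ := (0 : ℝ))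
    (s := univ) (F := fun s x => W (x - s) * F x) (F' := fun s x => -deriv W (x - s) * F x)
    (bound := fun x => M' * ‖F x‖) univ_mem
    (Eventually.of_forall fun s => hmeas hW.2.1.1 s) ?_ ?_ ?_ ?_ ?_).2
  · simpa [integral_neg] using H
  · refine hF.bdd_mul (c := M) (hW.2.1.1.comp
      (continuous_id.sub continuous_const)).aestronglyMeasurable
      (Eventually.of_forall fun x => hM _)
  · simpa [Pi.neg_def] using (hmeas hW.2.2.1 0).neg
  · refine Eventually.of_forall fun x s _ => ?_
    rw [norm_mul, norm_neg]
    exact mul_le_mul_of_nonneg_right (hM' _) (norm_nonneg _)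
  · exact hF.norm.const_mul M'
  · refine Eventually.of_forall fun x s _ => ?_
    have h1 : HasDerivAt (fun s : ℝ => x - s) (-1) s := by
      simpa using (hasDerivAt_id s).const_sub x
    have h2 := ((hW.1 (x - s)).hasDerivAt.comp s h1).mul_const (F x)
    simpa using h2

/-- Integration by parts against a `BC¹` weight. -/
theorem IsWeakDeriv.inner_mulL_add {W : ℝ → ℝ} (hW : IsBC1 W) {f f' g g' : L2R}
    (hf : IsWeakDeriv f f') (hg : IsWeakDeriv g g') :
    ⟪mulL hW.2.1.memLp_top f, g'⟫ + ⟪mulL hW.2.1.memLp_top f', g⟫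
      = - ⟪mulL hW.2.2.memLp_top f, g⟫ := by
  -- Same translation argument: the product rule gives the left-hand side, while a change of
  -- variables moves the shift onto W, whose derivative gives the right-hand side.
  have H := ((mulL hW.2.1.memLp_top).hasFDerivAt.comp_hasDerivAt 0
    hf.hasDerivAt_shift).inner ℝ hg.hasDerivAt_shift
  simp only [Function.comp_apply, shift_zero] at H
  rw [inner_mulL hW.2.2.memLp_top]
  refine H.unique ?_
  simp only [inner_mulL, integral_mul_shift_mul_shift]
  exact hW.hasDerivAt_integral_sub_mul (integrable_L2R_mul_L2R f g)

/-! ### Coordinate maps and integration by parts in H² -/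

namespace H2

/-- The map `f ↦ f` from `H²(ℝ)` to `L²(ℝ)`. -/
noncomputable def fnL : H2 →L[ℝ] L2R :=
  (PiLp.proj 2 (fun _ : Fin 3 => L2R) 0 : _ →L[ℝ] L2R).comp h2Submodule.subtypeL

/-- The map `f ↦ f'` from `H²(ℝ)` to `L²(ℝ)`. -/
noncomputable def gradL : H2 →L[ℝ] L2R :=
  (PiLp.proj 2 (fun _ : Fin 3 => L2R) 1 : _ →L[ℝ] L2R).comp h2Submodule.subtypeL

/-- The map `f ↦ f''` from `H²(ℝ)` to `L²(ℝ)`. -/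
noncomputable def lapL : H2 →L[ℝ] L2R :=
  (PiLp.proj 2 (fun _ : Fin 3 => L2R) 2 : _ →L[ℝ] L2R).comp h2Submodule.subtypeL

theorem norm_sq_eq (f : H2) : ‖f‖ ^ 2 = ‖f.fn‖ ^ 2 + ‖f.grad‖ ^ 2 + ‖f.lap‖ ^ 2 := by
  rw [Submodule.coe_norm, PiLp.norm_sq_eq_of_L2, Fin.sum_univ_three]
  rfl

theorem isWeakDeriv_fn (f : H2) : IsWeakDeriv f.fn f.grad := f.2.1

theorem isWeakDeriv_grad (f : H2) : IsWeakDeriv f.grad f.lap := f.2.2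

theorem inner_lap (f g : H2) : ⟪f.fn, g.lap⟫ = -⟪f.grad, g.grad⟫ :=
  eq_neg_of_add_eq_zero_left (f.isWeakDeriv_fn.inner_add_inner g.isWeakDeriv_grad)

end H2

/-! ### The Lyapunov functional -/

section Lyapunov

variable {V : ℝ → ℝ} (hV : IsBC1 V)

/-- The total energy of the state `(p, q) = (u, u_t)`. -/
noncomputable def stateEnergy (p q : H2) : ℝ :=
  1 / 2 * (⟪q.fn, q.fn⟫ + ⟪q.grad, q.grad⟫ + ⟪p.grad, p.grad⟫
    + ⟪mulL hV.2.1.memLp_top p.fn, p.fn⟫)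

/-- The energy obtained by testing the equation with `-Δu_t`. -/
noncomputable def secondEnergy (p q : H2) : ℝ :=
  1 / 2 * (⟪q.grad, q.grad⟫ + ⟪q.lap, q.lap⟫ + ⟪p.lap, p.lap⟫
    + ⟪mulL hV.2.1.memLp_top p.grad, p.grad⟫) + ⟪mulL hV.2.2.memLp_top p.fn, p.grad⟫

/-- The functional obtained by testing the equation with `u`. -/
noncomputable def crossEnergy (p q : H2) : ℝ :=
  ⟪q.fn, p.fn⟫ + ⟪q.grad, p.grad⟫ + 1 / 2 * ⟪p.fn, p.fn⟫

theorem hasDerivWithinAt_fn {u : ℝ → H2} {u' : H2} {s : Set ℝ} {t : ℝ}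
    (h : HasDerivWithinAt u u' s t) : HasDerivWithinAt (fun t => (u t).fn) u'.fn s t :=
  H2.fnL.hasFDerivAt.comp_hasDerivWithinAt t h

theorem hasDerivWithinAt_grad {u : ℝ → H2} {u' : H2} {s : Set ℝ} {t : ℝ}
    (h : HasDerivWithinAt u u' s t) : HasDerivWithinAt (fun t => (u t).grad) u'.grad s t :=
  H2.gradL.hasFDerivAt.comp_hasDerivWithinAt t h

theorem hasDerivWithinAt_lap {u : ℝ → H2} {u' : H2} {s : Set ℝ} {t : ℝ}
    (h : HasDerivWithinAt u u' s t) : HasDerivWithinAt (fun t => (u t).lap) u'.lap s t :=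
  H2.lapL.hasFDerivAt.comp_hasDerivWithinAt t h

variable {u v : ℝ → H2} {w : H2} {s : Set ℝ} {t : ℝ}

theorem hasDerivWithinAt_inner_mulL {W : ℝ → ℝ} (hW : MemLp W ∞ volume) {f g : ℝ → L2R}
    {f' g' : L2R} (hf : HasDerivWithinAt f f' s t) (hg : HasDerivWithinAt g g' s t) :
    HasDerivWithinAt (fun t => ⟪mulL hW (f t), g t⟫)
      (⟪mulL hW (f t), g'⟫ + ⟪mulL hW f', g t⟫) s t :=
  ((mulL hW).hasFDerivAt.comp_hasDerivWithinAt t hf).inner ℝ hg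

theorem hasDerivWithinAt_stateEnergy (hu : HasDerivWithinAt u (v t) s t)
    (hv : HasDerivWithinAt v w s t) :
    HasDerivWithinAt (fun t => stateEnergy hV (u t) (v t))
      (⟪w.fn, (v t).fn⟫ + ⟪w.grad, (v t).grad⟫ + ⟪(u t).grad, (v t).grad⟫
        + ⟪mulL hV.2.1.memLp_top (u t).fn, (v t).fn⟫) s t := by
  have hv0 := hasDerivWithinAt_fn hv
  have hv1 := hasDerivWithinAt_grad hv
  have hu1 := hasDerivWithinAt_grad hu
  have hu0 := hasDerivWithinAt_fn hu
  refine (((((hv0.inner ℝ hv0).add (hv1.inner ℝ hv1)).add (hu1.inner ℝ hu1)).add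
    (hasDerivWithinAt_inner_mulL hV.2.1.memLp_top hu0 hu0)).const_mul (1 / 2)).congr_deriv ?_
  rw [inner_mulL_comm _ (v t).fn, real_inner_comm w.fn, real_inner_comm w.grad,
    real_inner_comm (u t).grad]
  ring

theorem hasDerivWithinAt_secondEnergy (hu : HasDerivWithinAt u (v t) s t)
    (hv : HasDerivWithinAt v w s t) :
    HasDerivWithinAt (fun t => secondEnergy hV (u t) (v t))
      (⟪w.grad, (v t).grad⟫ + ⟪w.lap, (v t).lap⟫ + ⟪(u t).lap, (v t).lap⟫
        + ⟪mulL hV.2.1.memLp_top (u t).grad, (v t).grad⟫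
        + (⟪mulL hV.2.2.memLp_top (u t).fn, (v t).grad⟫
          + ⟪mulL hV.2.2.memLp_top (v t).fn, (u t).grad⟫)) s t := by
  have hv1 := hasDerivWithinAt_grad hv
  have hv2 := hasDerivWithinAt_lap hv
  have hu0 := hasDerivWithinAt_fn hu
  have hu1 := hasDerivWithinAt_grad hu
  have hu2 := hasDerivWithinAt_lap hu
  refine ((((((hv1.inner ℝ hv1).add (hv2.inner ℝ hv2)).add (hu2.inner ℝ hu2)).add
    (hasDerivWithinAt_inner_mulL hV.2.1.memLp_top hu1 hu1)).const_mul (1 / 2)).add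
    (hasDerivWithinAt_inner_mulL hV.2.2.memLp_top hu0 hu1)).congr_deriv ?_
  rw [inner_mulL_comm _ (v t).grad (u t).grad, real_inner_comm w.grad, real_inner_comm w.lap,
    real_inner_comm (u t).lap]
  ring

theorem hasDerivWithinAt_crossEnergy (hu : HasDerivWithinAt u (v t) s t)
    (hv : HasDerivWithinAt v w s t) :
    HasDerivWithinAt (fun t => crossEnergy (u t) (v t))
      (‖(v t).fn‖ ^ 2 + ‖(v t).grad‖ ^ 2
        + (⟪w.fn, (u t).fn⟫ + ⟪w.grad, (u t).grad⟫ + ⟪(v t).fn, (u t).fn⟫)) s t := by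
  have hv0 := hasDerivWithinAt_fn hv
  have hv1 := hasDerivWithinAt_grad hv
  have hu0 := hasDerivWithinAt_fn hu
  have hu1 := hasDerivWithinAt_grad hu
  refine (((hv0.inner ℝ hu0).add (hv1.inner ℝ hu1)).add
    ((hu0.inner ℝ hu0).const_mul (1 / 2))).congr_deriv ?_
  rw [real_inner_comm (v t).fn (u t).fn, real_inner_self_eq_norm_sq, real_inner_self_eq_norm_sq]
  ring

/-- The stationary form of the equation, for `p = u`, `q = u_t` and `w = u_tt`. -/
def StateEqn (p q w : H2) : Prop :=
  w.fn - w.lap - p.lap + mulL hV.2.1.memLp_top p.fn + q.fn = 0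

variable {hV} {p q : H2}

theorem StateEqn.inner_eq_zero (h : StateEqn hV p q w) (f : L2R) :
    ⟪w.fn, f⟫ - ⟪w.lap, f⟫ - ⟪p.lap, f⟫ + ⟪mulL hV.2.1.memLp_top p.fn, f⟫ + ⟪q.fn, f⟫ = 0 := by
  rw [← inner_sub_left, ← inner_sub_left, ← inner_add_left, ← inner_add_left, h, inner_zero_left]

theorem StateEqn.test_fn (h : StateEqn hV p q w) (f : H2) :
    ⟪w.fn, f.fn⟫ + ⟪w.grad, f.grad⟫ + ⟪p.grad, f.grad⟫
      + ⟪mulL hV.2.1.memLp_top p.fn, f.fn⟫ + ⟪q.fn, f.fn⟫ = 0 := by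
  have h0 := h.inner_eq_zero f.fn
  rw [real_inner_comm f.fn w.lap, real_inner_comm f.fn p.lap, H2.inner_lap, H2.inner_lap,
    real_inner_comm w.grad, real_inner_comm p.grad] at h0
  linarith

/-- Pair the equation with Δq. Integrating the potential term by parts leaves ⟪V' p, ∇q⟫, which is
why `secondEnergy` contains ⟪V' p, ∇p⟫: its time derivative contains this term, with only ⟪V' q, ∇p⟫
left over. -/
theorem StateEqn.test_lap (h : StateEqn hV p q w) :
    ⟪w.grad, q.grad⟫ + ⟪w.lap, q.lap⟫ + ⟪p.lap, q.lap⟫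
      + ⟪mulL hV.2.1.memLp_top p.grad, q.grad⟫ + ⟪mulL hV.2.2.memLp_top p.fn, q.grad⟫
      = -‖q.grad‖ ^ 2 := by
  have h0 := h.inner_eq_zero q.lap
  have h1 := p.isWeakDeriv_fn.inner_mulL_add hV q.isWeakDeriv_grad
  rw [H2.inner_lap, H2.inner_lap, real_inner_self_eq_norm_sq] at h0
  linarith

end Lyapunov

/-! ### Positivity, upper bounds and dissipation of the Lyapunov functional -/

section Bounds

variable {V : ℝ → ℝ} (hV : IsBC1 V)

theorem abs_inner_mulL_le {W : ℝ → ℝ} (hW : MemLp W ∞ volume) (f g : L2R) :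
    |⟪mulL hW f, g⟫| ≤ lpNorm W ∞ volume * (‖f‖ * ‖g‖) := by
  rw [← mul_assoc]
  exact (abs_real_inner_le_norm _ _).trans
    (mul_le_mul_of_nonneg_right (norm_mulL_le hW f) (norm_nonneg g))

theorem inner_mulL_self_nonneg {W : ℝ → ℝ} (hW : MemLp W ∞ volume) (hpos : ∀ x, 0 ≤ W x)
    (f : L2R) : 0 ≤ ⟪mulL hW f, f⟫ := by
  rw [inner_mulL]
  exact integral_nonneg fun x => mul_nonneg (hpos x) (mul_self_nonneg _)

/-- A combination of the energies which is nonnegative and decays at least at the rate given by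
the total energy. -/
noncomputable def lyapunov (p q : H2) : ℝ :=
  (8 * lpNorm (deriv V) ∞ volume ^ 2 + 2) * stateEnergy hV p q + 2 * secondEnergy hV p q
    + crossEnergy p q

variable {hV} {p q w : H2}

theorem stateEnergy_nonneg (hpos : ∀ x, 0 ≤ V x) : 0 ≤ stateEnergy hV p q := by
  have := inner_mulL_self_nonneg hV.2.1.memLp_top hpos p.fn
  simp only [stateEnergy, real_inner_self_eq_norm_sq]
  positivity

theorem lyapunov_nonneg (hpos : ∀ x, 0 ≤ V x) : 0 ≤ lyapunov hV p q := by
  have hM := inner_mulL_self_nonneg hV.2.1.memLp_top hpos p.fn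
  have hM' := inner_mulL_self_nonneg hV.2.1.memLp_top hpos p.grad
  have hN := neg_le_of_abs_le (abs_inner_mulL_le hV.2.2.memLp_top p.fn p.grad)
  have h0 := neg_le_of_abs_le (abs_real_inner_le_norm q.fn p.fn)
  have h1 := neg_le_of_abs_le (abs_real_inner_le_norm q.grad p.grad)
  simp only [lyapunov, stateEnergy, secondEnergy, crossEnergy, real_inner_self_eq_norm_sq]
  set n := lpNorm (deriv V) ∞ volume
  have hM2 := mul_nonneg (sq_nonneg n) hM
  -- The ½‖p‖² of `crossEnergy` is split in two equal parts: one absorbs 2n‖p‖‖∇p‖ at the cost of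
  -- 4n²‖∇p‖², the other ‖q‖‖p‖ at the cost of ‖q‖². The coefficient 8n² + 2 covers both costs.
  have e1 := sq_nonneg (1 / 2 * ‖p.fn‖ - 2 * n * ‖p.grad‖)
  have e2 := sq_nonneg (1 / 2 * ‖p.fn‖ - ‖q.fn‖)
  have e3 := sq_nonneg (‖q.grad‖ - ‖p.grad‖)
  have e4 := sq_nonneg (n * ‖q.fn‖)
  have e5 := sq_nonneg (n * ‖q.grad‖)
  have e6 := sq_nonneg ‖q.grad‖
  have e7 := sq_nonneg ‖q.lap‖
  have e8 := sq_nonneg ‖p.lap‖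
  have e9 := sq_nonneg ‖p.grad‖
  nlinarith only [hM, hM', hN, h0, h1, hM2, e1, e2, e3, e4, e5, e6, e7, e8, e9]

theorem stateEnergy_le : stateEnergy hV p q ≤
    1 / 2 * (1 + lpNorm V ∞ volume) * (‖p‖ ^ 2 + ‖q‖ ^ 2) := by
  have hM := le_of_abs_le (abs_inner_mulL_le hV.2.1.memLp_top p.fn p.fn)
  have hm : 0 ≤ lpNorm V ∞ volume := lpNorm_nonneg
  simp only [stateEnergy, real_inner_self_eq_norm_sq, H2.norm_sq_eq]
  set m := lpNorm V ∞ volume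
  nlinarith only [hM, hm, sq_nonneg ‖p.fn‖, sq_nonneg ‖p.lap‖, sq_nonneg ‖q.lap‖,
    mul_nonneg hm (sq_nonneg ‖p.grad‖), mul_nonneg hm (sq_nonneg ‖p.lap‖),
    mul_nonneg hm (sq_nonneg ‖q.fn‖), mul_nonneg hm (sq_nonneg ‖q.grad‖),
    mul_nonneg hm (sq_nonneg ‖q.lap‖)]

theorem secondEnergy_le : secondEnergy hV p q ≤
    (1 / 2 * (1 + lpNorm V ∞ volume) + lpNorm (deriv V) ∞ volume) * (‖p‖ ^ 2 + ‖q‖ ^ 2) := by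
  have hM := le_of_abs_le (abs_inner_mulL_le hV.2.1.memLp_top p.grad p.grad)
  have hN := le_of_abs_le (abs_inner_mulL_le hV.2.2.memLp_top p.fn p.grad)
  have hm : 0 ≤ lpNorm V ∞ volume := lpNorm_nonneg
  have hn : 0 ≤ lpNorm (deriv V) ∞ volume := lpNorm_nonneg
  simp only [secondEnergy, real_inner_self_eq_norm_sq, H2.norm_sq_eq]
  set m := lpNorm V ∞ volume
  set n := lpNorm (deriv V) ∞ volume
  nlinarith only [hM, hN, sq_nonneg ‖p.fn‖, sq_nonneg ‖p.grad‖, sq_nonneg ‖q.fn‖,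
    mul_nonneg hm (sq_nonneg ‖p.fn‖), mul_nonneg hm (sq_nonneg ‖p.lap‖),
    mul_nonneg hm (sq_nonneg ‖q.fn‖), mul_nonneg hm (sq_nonneg ‖q.grad‖),
    mul_nonneg hm (sq_nonneg ‖q.lap‖), mul_nonneg hn (sq_nonneg (‖p.fn‖ - ‖p.grad‖)),
    mul_nonneg hn (sq_nonneg ‖p.fn‖), mul_nonneg hn (sq_nonneg ‖p.grad‖),
    mul_nonneg hn (sq_nonneg ‖p.lap‖),
    mul_nonneg hn (sq_nonneg ‖q.fn‖), mul_nonneg hn (sq_nonneg ‖q.grad‖),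
    mul_nonneg hn (sq_nonneg ‖q.lap‖)]

theorem crossEnergy_le : crossEnergy p q ≤ ‖p‖ ^ 2 + ‖q‖ ^ 2 := by
  have h0 := real_inner_le_norm q.fn p.fn
  have h1 := real_inner_le_norm q.grad p.grad
  simp only [crossEnergy, real_inner_self_eq_norm_sq, H2.norm_sq_eq]
  nlinarith only [h0, h1, sq_nonneg (‖q.fn‖ - ‖p.fn‖), sq_nonneg (‖q.grad‖ - ‖p.grad‖),
    sq_nonneg ‖p.grad‖, sq_nonneg ‖q.grad‖, sq_nonneg ‖q.fn‖, sq_nonneg ‖p.lap‖,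
    sq_nonneg ‖q.lap‖]

/-- The constant in the decay estimate, in terms of `‖V‖_∞` and `‖V'‖_∞`. -/
noncomputable def decayConst (m n : ℝ) : ℝ :=
  (8 * n ^ 2 + 3) * (1 / 2 * (1 + |m|)) + 2 * (1 / 2 * (1 + |m|) + |n|) + 1

/-- The absolute values in `decayConst` give positivity for all real arguments, not only for norms.
-/
theorem decayConst_pos (m n : ℝ) : 0 < decayConst m n := by
  unfold decayConst
  positivity

theorem lyapunov_add_stateEnergy_le : lyapunov hV p q + stateEnergy hV p q ≤
    decayConst (lpNorm V ∞ volume) (lpNorm (deriv V) ∞ volume) * (‖p‖ ^ 2 + ‖q‖ ^ 2) := by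
  have h1 := stateEnergy_le (hV := hV) (p := p) (q := q)
  have h2 := secondEnergy_le (hV := hV) (p := p) (q := q)
  have h3 := crossEnergy_le (p := p) (q := q)
  have hn := mul_le_mul_of_nonneg_left h1
    (by positivity : 0 ≤ 8 * lpNorm (deriv V) ∞ volume ^ 2 + 3)
  rw [decayConst, abs_of_nonneg (lpNorm_nonneg (f := V)),
    abs_of_nonneg (lpNorm_nonneg (f := deriv V)), lyapunov]
  linarith

variable {u v : ℝ → H2} {s : Set ℝ} {t : ℝ}

theorem hasDerivWithinAt_stateEnergy_of_stateEqn (hu : HasDerivWithinAt u (v t) s t)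
    (hv : HasDerivWithinAt v w s t) (h : StateEqn hV (u t) (v t) w) :
    HasDerivWithinAt (fun t => stateEnergy hV (u t) (v t)) (-‖(v t).fn‖ ^ 2) s t := by
  refine (hasDerivWithinAt_stateEnergy hV hu hv).congr_deriv ?_
  have h0 := h.test_fn (v t)
  rw [real_inner_self_eq_norm_sq] at h0
  linarith

theorem exists_hasDerivWithinAt_lyapunov (hu : HasDerivWithinAt u (v t) s t)
    (hv : HasDerivWithinAt v w s t) (h : StateEqn hV (u t) (v t) w) (hpos : ∀ x, 0 ≤ V x) :
    ∃ d ≤ -stateEnergy hV (u t) (v t),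
      HasDerivWithinAt (fun t => lyapunov hV (u t) (v t)) d s t := by
  refine ⟨_, ?_, (((hasDerivWithinAt_stateEnergy_of_stateEqn hu hv h).const_mul _).add
    ((hasDerivWithinAt_secondEnergy hV hu hv).const_mul 2)).add
    (hasDerivWithinAt_crossEnergy hu hv)⟩
  have h1 := h.test_lap
  have h2 := h.test_fn (u t)
  have hM := inner_mulL_self_nonneg hV.2.1.memLp_top hpos (u t).fn
  have hN := le_of_abs_le (abs_inner_mulL_le hV.2.2.memLp_top (v t).fn (u t).grad)
  rw [real_inner_self_eq_norm_sq] at h2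
  simp only [stateEnergy, real_inner_self_eq_norm_sq]
  set n := lpNorm (deriv V) ∞ volume
  -- The leftover 2⟪V' u_t, ∇u⟫ is at most 4n²‖u_t‖² + ¼‖∇u‖², which still leaves ¾‖∇u‖² of
  -- dissipation, more than the ½‖∇u‖² in the energy.
  nlinarith only [h1, h2, hM, hN, sq_nonneg (2 * n * ‖(v t).fn‖ - 1 / 2 * ‖(u t).grad‖),
    sq_nonneg (n * ‖(v t).fn‖), sq_nonneg ‖(v t).fn‖, sq_nonneg ‖(v t).grad‖,
    sq_nonneg ‖(u t).grad‖]

end Bounds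

/-! ### Decay along strong solutions -/

namespace IsStrongSolution

variable {V : ℝ → ℝ} {u₀ u₁ : H2} {u : ℝ → H2}

theorem contDiffOn_timeDeriv (h : IsStrongSolution V u₀ u₁ u) :
    ContDiffOn ℝ 1 (timeDeriv u) (Ici 0) :=
  h.contDiffOn.derivWithin (uniqueDiffOn_Ici 0) (by norm_num)

theorem hasDerivWithinAt (h : IsStrongSolution V u₀ u₁ u) {t : ℝ} (ht : 0 ≤ t) :
    HasDerivWithinAt u (timeDeriv u t) (Ici 0) t :=
  (h.contDiffOn.differentiableOn (by norm_num) t ht).hasDerivWithinAt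

theorem hasDerivWithinAt_timeDeriv (h : IsStrongSolution V u₀ u₁ u) {t : ℝ} (ht : 0 ≤ t) :
    HasDerivWithinAt (timeDeriv u) (timeDeriv (timeDeriv u) t) (Ici 0) t :=
  (h.contDiffOn_timeDeriv.differentiableOn (by norm_num) t ht).hasDerivWithinAt

theorem stateEqn (h : IsStrongSolution V u₀ u₁ u) (hV : IsBC1 V) {t : ℝ} (ht : 0 < t) :
    StateEqn hV (u t) (timeDeriv u t) (timeDeriv (timeDeriv u) t) := by
  refine Lp.ext ?_
  filter_upwards [h.eqn t ht, coeFn_mulL hV.2.1.memLp_top (u t).fn,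
    Lp.coeFn_zero ℝ 2 (volume : Measure ℝ),
    Lp.coeFn_add ((timeDeriv (timeDeriv u) t).fn - (timeDeriv (timeDeriv u) t).lap - (u t).lap
      + mulL hV.2.1.memLp_top (u t).fn) (timeDeriv u t).fn,
    Lp.coeFn_add ((timeDeriv (timeDeriv u) t).fn - (timeDeriv (timeDeriv u) t).lap - (u t).lap)
      (mulL hV.2.1.memLp_top (u t).fn),
    Lp.coeFn_sub ((timeDeriv (timeDeriv u) t).fn - (timeDeriv (timeDeriv u) t).lap) (u t).lap,
    Lp.coeFn_sub (timeDeriv (timeDeriv u) t).fn (timeDeriv (timeDeriv u) t).lap]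
    with x hx hm hz h1 h2 h3 h4
  rw [h1, Pi.add_apply, h2, Pi.add_apply, h3, Pi.sub_apply, h4, Pi.sub_apply, hm, hz, hx,
    Pi.zero_apply]

theorem energy_eq (hV : IsBC1 V) (hpos : ∀ x, 0 ≤ V x) (u : ℝ → H2) (t : ℝ) :
    energy V u t = stateEnergy hV (u t) (timeDeriv u t) := by
  rw [energy, stateEnergy, lpNorm_sqrt_mul_sq hV.2.1 hpos]
  simp only [real_inner_self_eq_norm_sq]

theorem energy_mul_le (h : IsStrongSolution V u₀ u₁ u) (hV : IsBC1 V) (hpos : ∀ x, 0 ≤ V x)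
    {t : ℝ} (ht : 0 ≤ t) : energy V u t * (1 + t) ≤
      decayConst (lpNorm V ∞ volume) (lpNorm (deriv V) ∞ volume) * (‖u₀‖ ^ 2 + ‖u₁‖ ^ 2) := by
  let L : ℝ → ℝ := fun t => lyapunov hV (u t) (timeDeriv u t)
  let E : ℝ → ℝ := fun t => stateEnergy hV (u t) (timeDeriv u t)
  -- Continuity up to t = 0 rests on the derivative formulas that do not involve the equation, which
  -- is available only for t > 0.
  have hE : ContinuousOn E (Ici 0) := fun r hr => (hasDerivWithinAt_stateEnergy hV
    (h.hasDerivWithinAt hr) (h.hasDerivWithinAt_timeDeriv hr)).continuousWithinAt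
  have hL : ContinuousOn L (Ici 0) := fun r hr =>
    (((hasDerivWithinAt_stateEnergy hV (h.hasDerivWithinAt hr)
      (h.hasDerivWithinAt_timeDeriv hr)).const_mul _).add
    ((hasDerivWithinAt_secondEnergy hV (h.hasDerivWithinAt hr)
      (h.hasDerivWithinAt_timeDeriv hr)).const_mul 2)).add
    (hasDerivWithinAt_crossEnergy (h.hasDerivWithinAt hr)
      (h.hasDerivWithinAt_timeDeriv hr)) |>.continuousWithinAt
  have hd : ∀ r ∈ interior (Ici (0 : ℝ)), ∃ d ≤ 0,
      HasDerivWithinAt (fun r => L r + E r * (1 + r)) d (interior (Ici 0)) r := by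
    intro r hr
    rw [interior_Ici] at hr ⊢
    have hr0 : 0 < r := hr
    have hu := (h.hasDerivWithinAt hr0.le).mono Ioi_subset_Ici_self
    have hv := (h.hasDerivWithinAt_timeDeriv hr0.le).mono Ioi_subset_Ici_self
    obtain ⟨d, hd, hLd⟩ := exists_hasDerivWithinAt_lyapunov hu hv (h.stateEqn hV hr0) hpos
    refine ⟨_, ?_, hLd.add ((hasDerivWithinAt_stateEnergy_of_stateEqn hu hv
      (h.stateEqn hV hr0)).mul ((hasDerivWithinAt_id r _).const_add 1))⟩
    -- The product rule for E(r)(1 + r) produces +E, cancelled by d ≤ -E, and this term with a minus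
    -- sign.
    have : 0 ≤ ‖(timeDeriv u r).fn‖ ^ 2 * (1 + r) := by positivity
    linarith
  have hanti : AntitoneOn (fun r => L r + E r * (1 + r)) (Ici 0) := by
    refine antitoneOn_of_deriv_nonpos (convex_Ici 0) (hL.add (hE.mul (by fun_prop)))
      (fun r hr => ?_) fun r hr => ?_
    · obtain ⟨d, -, hd⟩ := hd r hr
      exact hd.differentiableWithinAt
    · obtain ⟨d, hd0, hd⟩ := hd r hr
      rwa [(hd.hasDerivAt (isOpen_interior.mem_nhds hr)).deriv]
  have h0 := hanti self_mem_Ici ht ht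
  have hL0 : 0 ≤ L t := lyapunov_nonneg hpos
  have hb := lyapunov_add_stateEnergy_le (hV := hV) (p := u₀) (q := u₁)
  simp only [L, E, h.init, h.init_deriv] at h0 hL0
  rw [energy_eq hV hpos]
  linarith

end IsStrongSolution

theorem proposition2p1 :
    ∃ C : ℝ → ℝ → ℝ, (∀ a b : ℝ, 0 < C a b) ∧
      ∀ V : ℝ → ℝ, IsBC1 V → (∀ x, 0 < V x) →
      ∀ u₀ u₁ : H2,
        MemLp (fun x => (u₀.fn x + u₁.fn x - u₁.lap x) / √(V x)) 2 volume →
      ∀ u : ℝ → H2, IsStrongSolution V u₀ u₁ u →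
      ∀ t : ℝ, 0 ≤ t →
        energy V u t ≤
          C (lpNorm V ∞ volume) (lpNorm (deriv V) ∞ volume) *
            (‖u₀‖ ^ 2 + ‖u₁‖ ^ 2
              + lpNorm (fun x => (u₀.fn x + u₁.fn x - u₁.lap x) / √(V x)) 2 volume ^ 2) *
            (1 + t)⁻¹ := by
  refine ⟨decayConst, decayConst_pos, fun V hV hpos u₀ u₁ _ u hu t ht => ?_⟩
  rw [← div_eq_mul_inv, le_div_iff₀ (by positivity)]
  refine (hu.energy_mul_le hV (fun x => (hpos x).le) ht).trans ?_
  exact mul_le_mul_of_nonneg_left (le_add_of_nonneg_right (sq_nonneg _)) (decayConst_pos _ _).le
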